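/- Let $\mathfrak H=\mathfrak H_0\oplus\mathfrak H_1$ be a complex Hilbert space decomposed into complementary orthogonal closed subspaces. Let $A_0$ and $A_1$ be closed (possibly unbounded) linear operators on $\mathfrak H_0$ and $\mathfrak H_1$, let $B:\mathfrak H_1\to\mathfrak H_0$ and $C:\mathfrak H_0\to\mathfrak H_1$ be bounded linear operators with $C=-B^*$, and put $$A=\begin{pmatrix}A_0&0\\0&A_1\end{pmatrix},\qquad V=\begin{pmatrix}0&B\\C&0\end{pmatrix},\qquad L=A+V,\qquad \mathrm{Dom}(L)=\mathrm{Dom}(A)=\mathrm{Dom}(A_0)\oplus\mathrm{Dom}(A_1).$$ For an operator $T$, let $W(T)=\{(Tx,x) : x\in\mathrm{Dom}(T),\ \|x\|=1\}$ be its numerical range, $\rho(T)$ its resolvent set (the $z\in\mathbb C$ for which $T-z:\mathrm{Dom}(T)\to\mathfrak H$ has a bounded, everywhere defined inverse) and $\mathrm{spec}(T)=\mathbb C\setminus\rho(T)$ its spectrum. Let $a,b\in\mathbb R$. (i) If $\mathrm{Re}\,w\le a$ for all $w\in W(A)$ and $\rho(A)\cap\{z\in\mathbb C : \mathrm{Re}\,z>a\}\neq\emptyset$,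 then $\mathrm{Re}\,z\le a$ for all $z\in\mathrm{spec}(L)$. (ii) If $\mathrm{Re}\,w\ge b$ for all $w\in W(A)$ and $\rho(A)\cap\{z\in\mathbb C : \mathrm{Re}\,z<b\}\neq\emptyset$, then $\mathrm{Re}\,z\ge b$ for all $z\in\mathrm{spec}(L)$. In particular, if $A$ is self-adjoint, then $$\inf\mathrm{spec}(A)\le\mathrm{Re}\,z\le\sup\mathrm{spec}(A)\qquad\text{for all } z\in\mathrm{spec}(L),$$ where the infimum and the supremum are taken in $[-\infty,\infty]$. No bound on $\|V\|$ is assumed in any of these statements. -/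

import Mathlib

open scoped InnerProductSpace

namespace BlockOp

noncomputable section

/-- The resolvent set of a (possibly unbounded) operator `T` on a complex normed space: those `z`
for which `T - z : Dom T → E` has a bounded, everywhere defined two-sided inverse `R`. -/
def resolventSet {E : Type*} [NormedAddCommGroup E] [NormedSpace ℂ E] (T : E →ₗ.[ℂ] E) : Set ℂ :=
  {z | ∃ R : E →L[ℂ] E,
    (∀ y : E, ∃ h : R y ∈ T.domain, T ⟨R y, h⟩ - z • R y = y) ∧
    (∀ x : T.domain, R (T x - z • (x : E)) = x)}

/-- The spectrum: the complement of the resolvent set. -/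
def spec {E : Type*} [NormedAddCommGroup E] [NormedSpace ℂ E] (T : E →ₗ.[ℂ] E) : Set ℂ :=
  (resolventSet T)ᶜ

/-- The numerical range `{(T x, x) | x ∈ Dom T, ‖x‖ = 1}`. Mathlib's inner product is linear in the
second argument, so `(T x, x)`, with a product linear in the first argument, is `⟪x, T x⟫`. -/
def numericalRange {E : Type*} [NormedAddCommGroup E] [InnerProductSpace ℂ E]
    (T : E →ₗ.[ℂ] E) : Set ℂ :=
  {w | ∃ x : T.domain, ‖(x : E)‖ = 1 ∧ ⟪(x : E), T x⟫_ℂ = w}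

/-- The block diagonal operator `diag(A₀, A₁)` on `H = H₀ ⊕ H₀ᗮ`: its domain is
`Dom A₀ ⊕ Dom A₁`, i.e. the vectors whose two components lie in `Dom A₀` and `Dom A₁`. -/
def blockDiag {H : Type*} [NormedAddCommGroup H] [InnerProductSpace ℂ H]
    (H₀ : Submodule ℂ H) [H₀.HasOrthogonalProjection]
    (A₀ : H₀ →ₗ.[ℂ] H₀) (A₁ : H₀ᗮ →ₗ.[ℂ] H₀ᗮ) : H →ₗ.[ℂ] H where
  domain := A₀.domain.comap H₀.orthogonalProjectionOnto.toLinearMap ⊓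
    A₁.domain.comap H₀ᗮ.orthogonalProjectionOnto.toLinearMap
  toFun :=
    { toFun := fun x =>
        ((A₀ ⟨H₀.orthogonalProjectionOnto (x : H), x.2.1⟩ : H₀) : H) +
          ((A₁ ⟨H₀ᗮ.orthogonalProjectionOnto (x : H), x.2.2⟩ : H₀ᗮ) : H)
      map_add' := by
        intro x y
        have h0 : (⟨H₀.orthogonalProjectionOnto ((x + y : _) : H), (x + y).2.1⟩ : A₀.domain) =
            ⟨H₀.orthogonalProjectionOnto (x : H), x.2.1⟩ +
              ⟨H₀.orthogonalProjectionOnto (y : H), y.2.1⟩ := by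
          ext; simp
        have h1 : (⟨H₀ᗮ.orthogonalProjectionOnto ((x + y : _) : H), (x + y).2.2⟩ : A₁.domain) =
            ⟨H₀ᗮ.orthogonalProjectionOnto (x : H), x.2.2⟩ +
              ⟨H₀ᗮ.orthogonalProjectionOnto (y : H), y.2.2⟩ := by
          apply Subtype.ext
          exact map_add H₀ᗮ.orthogonalProjectionOnto (x : H) (y : H)
        rw [h0, h1, LinearPMap.map_add, LinearPMap.map_add, Submodule.coe_add, Submodule.coe_add]
        abel
      map_smul' := by
        intro c x
        have h0 : (⟨H₀.orthogonalProjectionOnto ((c • x : _) : H), (c • x).2.1⟩ : A₀.domain) =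
            c • ⟨H₀.orthogonalProjectionOnto (x : H), x.2.1⟩ := by
          apply Subtype.ext
          exact map_smul H₀.orthogonalProjectionOnto c (x : H)
        have h1 : (⟨H₀ᗮ.orthogonalProjectionOnto ((c • x : _) : H), (c • x).2.2⟩ : A₁.domain) =
            c • ⟨H₀ᗮ.orthogonalProjectionOnto (x : H), x.2.2⟩ := by
          apply Subtype.ext
          exact map_smul H₀ᗮ.orthogonalProjectionOnto c (x : H)
        rw [h0, h1, LinearPMap.map_smul, LinearPMap.map_smul]
        simp [smul_add] }

/-- The bounded off-diagonal operator `V (x₀ + x₁) = B x₁ + C x₀` on `H = H₀ ⊕ H₀ᗮ`. -/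
def offDiag {H : Type*} [NormedAddCommGroup H] [InnerProductSpace ℂ H]
    (H₀ : Submodule ℂ H) [H₀.HasOrthogonalProjection]
    (B : H₀ᗮ →L[ℂ] H₀) (C : H₀ →L[ℂ] H₀ᗮ) : H →L[ℂ] H :=
  H₀.subtypeL ∘L B ∘L H₀ᗮ.orthogonalProjectionOnto + H₀ᗮ.subtypeL ∘L C ∘L H₀.orthogonalProjectionOnto

/-- The sum `T + V` of an operator `T` and a bounded operator `V`, with domain `Dom T`. -/
def addBounded {E : Type*} [NormedAddCommGroup E] [NormedSpace ℂ E]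
    (T : E →ₗ.[ℂ] E) (V : E →L[ℂ] E) : E →ₗ.[ℂ] E where
  domain := T.domain
  toFun := T.toFun + V.toLinearMap ∘ₗ T.domain.subtype

/-- The infimum of the real points of a set of complex numbers, in the extended reals. -/
def realInf (S : Set ℂ) : EReal := sInf ((fun t : ℝ => (t : EReal)) '' {t : ℝ | (t : ℂ) ∈ S})

/-- The supremum of the real points of a set of complex numbers, in the extended reals. -/
def realSup (S : Set ℂ) : EReal := sSup ((fun t : ℝ => (t : EReal)) '' {t : ℝ | (t : ℂ) ∈ S})

end

end BlockOp

/-!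
Suppose that the numerical range of `T` lies in `b ≤ Re w` and that some `z` with `Re z < b` is in
its resolvent set. Then `(b - Re z) ‖x‖ ≤ ‖(T - z) x‖`, so the resolvent cannot blow up inside
`Re z < b`, and this whole open half plane lies in the resolvent set. Since `C = -B*`, the operator
`V` is skew-adjoint, and `T + V` satisfies the same numerical range bound. Whatever the size of
`V`, it is a small perturbation of `T - t` for real `t` far to the left, where
`‖(T - t)⁻¹‖ ≤ (b - t)⁻¹`; hence the resolvent set of `T + V` meets `Re z < b` as well, and so
contains it. Upper bounds follow by passing to `-T` and `-V`.

If `T` is symmetric and its resolvent set contains `(-∞, b)`, then for `t < b` the resolvent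
`(T - t)⁻¹` is a bounded self-adjoint operator without negative spectrum, hence positive; this
gives `t ≤ Re w` on the numerical range.
-/

namespace BlockOp

open scoped Pointwise

section Resolvent

variable {E : Type*} [NormedAddCommGroup E] [NormedSpace ℂ E]
  {T : E →ₗ.[ℂ] E} {R S : E →L[ℂ] E} {z w c : ℂ}

/-- `R` is the resolvent `(T - z)⁻¹` of the operator `T` at `z`: a bounded, everywhere defined
two-sided inverse of `T - z : Dom T → E`. -/
structure IsResolventAt (T : E →ₗ.[ℂ] E) (z : ℂ) (R : E →L[ℂ] E) : Prop where
  mem_domain (y : E) : R y ∈ T.domain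
  sub_smul_apply (y : E) : T ⟨R y, mem_domain y⟩ - z • R y = y
  apply_sub_smul (x : T.domain) : R (T x - z • (x : E)) = x

theorem mem_resolventSet_iff : z ∈ resolventSet T ↔ ∃ R, IsResolventAt T z R :=
  ⟨fun ⟨R, hR, hR'⟩ => ⟨R, fun y => (hR y).1, fun y => (hR y).2, hR'⟩,
    fun ⟨R, hR⟩ => ⟨R, fun y => ⟨hR.mem_domain y, hR.sub_smul_apply y⟩, hR.apply_sub_smul⟩⟩

theorem addBounded_apply (T : E →ₗ.[ℂ] E) (V : E →L[ℂ] E) (x : T.domain) :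
    addBounded T V x = T x + V x := rfl

theorem IsResolventAt.mem_resolventSet_addBounded [CompleteSpace E] (hR : IsResolventAt T z R)
    (K : E →L[ℂ] E) (hK : ‖K‖ * ‖R‖ < 1) : z ∈ resolventSet (addBounded T K) := by
  have hKR : IsUnit (1 + K * R) := by
    rw [← sub_neg_eq_add]
    refine isUnit_one_sub_of_norm_lt_one ?_
    rw [norm_neg]
    exact (norm_mul_le K R).trans_lt hK
  obtain ⟨G, hKRG, hGKR⟩ := isUnit_iff_exists.1 hKR
  have hfactor (x : T.domain) :
      T x + K x - z • (x : E) = (1 + K * R) (T x - z • (x : E)) := by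
    change _ = (T x - z • (x : E)) + K (R (T x - z • (x : E)))
    rw [hR.apply_sub_smul]
    abel
  refine mem_resolventSet_iff.2 ⟨R * G, fun y => hR.mem_domain (G y), fun y => ?_,
    fun (x : T.domain) => ?_⟩
  · let x : T.domain := ⟨R (G y), hR.mem_domain (G y)⟩
    calc T x + K x - z • (x : E) = (1 + K * R) (T x - z • (x : E)) := hfactor x
      _ = (1 + K * R) (G y) := by rw [hR.sub_smul_apply]
      _ = y := DFunLike.congr_fun hKRG y
  · calc R (G (T x + K x - z • (x : E))) = R (G ((1 + K * R) (T x - z • (x : E)))) := by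
          rw [hfactor]
      _ = R (T x - z • (x : E)) := congrArg R (DFunLike.congr_fun hGKR _)
      _ = x := hR.apply_sub_smul x

theorem IsResolventAt.of_addBounded_smul_one (hR : IsResolventAt (addBounded T (c • 1)) z R) :
    IsResolventAt T (z - c) R := by
  have hshift (x : T.domain) :
      T x - (z - c) • (x : E) = addBounded T (c • 1) x - z • (x : E) := by
    change _ = T x + c • (x : E) - z • (x : E)
    rw [sub_smul]
    abel
  exact ⟨hR.mem_domain, fun y => (hshift _).trans (hR.sub_smul_apply y),
    fun x => (congrArg R (hshift x)).trans (hR.apply_sub_smul x)⟩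

theorem IsResolventAt.mem_resolventSet_of_norm_sub_mul_lt_one [CompleteSpace E]
    (hR : IsResolventAt T z R) (hw : ‖w - z‖ * ‖R‖ < 1) : w ∈ resolventSet T := by
  have hK : ‖(z - w) • (1 : E →L[ℂ] E)‖ * ‖R‖ < 1 := by
    refine lt_of_le_of_lt ?_ hw
    rw [norm_smul, norm_sub_rev]
    gcongr
    exact mul_le_of_le_one_right (norm_nonneg _) ContinuousLinearMap.norm_id_le
  obtain ⟨S, hS⟩ := mem_resolventSet_iff.1 (hR.mem_resolventSet_addBounded _ hK)
  exact mem_resolventSet_iff.2 ⟨S, sub_sub_cancel z w ▸ hS.of_addBounded_smul_one⟩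

theorem isOpen_resolventSet [CompleteSpace E] (T : E →ₗ.[ℂ] E) : IsOpen (resolventSet T) := by
  refine isOpen_iff_mem_nhds.2 fun z hz => ?_
  obtain ⟨R, hR⟩ := mem_resolventSet_iff.1 hz
  have hcont : Continuous fun w => ‖w - z‖ * ‖R‖ := by fun_prop
  filter_upwards [hcont.continuousAt.eventually_lt_const (u := 1) (by simp)] with w hw
  exact hR.mem_resolventSet_of_norm_sub_mul_lt_one hw

theorem IsResolventAt.sub_eq_smul_mul (hR : IsResolventAt T z R) (hS : IsResolventAt T w S) :
    S - R = (w - z) • (R * S) := by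
  ext y
  have hy : T ⟨S y, hS.mem_domain y⟩ - z • S y = y + (w - z) • S y := by
    rw [← sub_add_sub_cancel _ (w • S y), hS.sub_smul_apply, sub_smul]
  have hRS : R (y + (w - z) • S y) = S y := hy ▸ hR.apply_sub_smul ⟨S y, hS.mem_domain y⟩
  rw [map_add, map_smul] at hRS
  exact sub_eq_of_eq_add' hRS.symm

theorem IsResolventAt.isUnit_smul_one_sub (hc : c ≠ 0) (hR : IsResolventAt T z R)
    (hS : IsResolventAt T (z + c⁻¹) S) : IsUnit (c • (1 : E →L[ℂ] E) - R) := by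
  have hRS : R * S = c • (S - R) := by simp [hR.sub_eq_smul_mul hS, hc]
  have hSR : S * R = c • (S - R) := by
    rw [← neg_sub, hS.sub_eq_smul_mul hR]
    simp [hc]
  -- `(c - R)⁻¹ = c⁻¹ (T - z) (T - (z + c⁻¹))⁻¹`
  refine isUnit_iff_exists.2 ⟨c⁻¹ • (1 + c⁻¹ • S), ?_, ?_⟩
  · simp only [sub_mul, mul_add, smul_mul_assoc, mul_smul_comm, one_mul, mul_one, hRS]
    match_scalars <;> field_simp <;> ring
  · simp only [mul_sub, add_mul, smul_mul_assoc, mul_smul_comm, one_mul, mul_one, hSR]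
    match_scalars <;> field_simp <;> ring

end Resolvent

section Neg

variable {E : Type*} [NormedAddCommGroup E] [NormedSpace ℂ E] {T : E →ₗ.[ℂ] E}

theorem addBounded_neg_neg (T : E →ₗ.[ℂ] E) (V : E →L[ℂ] E) :
    addBounded (-T) (-V) = -addBounded T V :=
  LinearPMap.ext rfl fun x hx _ => (neg_add (T ⟨x, hx⟩) (V x)).symm

theorem IsResolventAt.neg {R : E →L[ℂ] E} {z : ℂ} (hR : IsResolventAt T z R) :
    IsResolventAt (-T) (-z) (-R) := by
  refine ⟨fun y => T.domain.neg_mem (hR.mem_domain y), fun y => ?_, fun x => ?_⟩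
  · have hy : (-T) ⟨-R y, T.domain.neg_mem (hR.mem_domain y)⟩ = T ⟨R y, hR.mem_domain y⟩ :=
      neg_eq_iff_eq_neg.2 (T.map_neg ⟨R y, hR.mem_domain y⟩)
    exact (congrArg (· - -z • -R y) hy).trans (by rw [neg_smul_neg, hR.sub_smul_apply])
  · calc -R (-T x - -z • (x : E)) = R (T x - z • (x : E)) := by
          rw [← map_neg, neg_sub, neg_smul, neg_sub_neg]
      _ = x := hR.apply_sub_smul x

theorem resolventSet_neg (T : E →ₗ.[ℂ] E) : resolventSet (-T) = -resolventSet T := by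
  have hneg {T : E →ₗ.[ℂ] E} {z : ℂ} (hz : z ∈ resolventSet T) : -z ∈ resolventSet (-T) :=
    let ⟨R, hR⟩ := mem_resolventSet_iff.1 hz
    mem_resolventSet_iff.2 ⟨-R, hR.neg⟩
  ext z
  exact ⟨fun hz => neg_neg T ▸ hneg hz, fun hz => neg_neg z ▸ hneg hz⟩

theorem spec_neg (T : E →ₗ.[ℂ] E) : spec (-T) = -spec T := by
  rw [spec, resolventSet_neg]
  rfl

theorem neg_mem_spec_addBounded_neg {V : E →L[ℂ] E} {z : ℂ} (hz : z ∈ spec (addBounded T V)) :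
    -z ∈ spec (addBounded (-T) (-V)) := by
  rwa [addBounded_neg_neg, spec_neg, Set.neg_mem_neg]

theorem realInf_neg (S : Set ℂ) : realInf (-S) = -realSup S := by
  refine eq_of_forall_le_iff fun c => ?_
  rw [EReal.le_neg, realInf, realSup, le_sInf_iff, sSup_le_iff, Set.forall_mem_image,
    Set.forall_mem_image]
  refine (Equiv.neg ℝ).forall_congr fun t => ?_
  simp

end Neg

section NumericalRange

variable {E : Type*} [NormedAddCommGroup E] [InnerProductSpace ℂ E]
  {T : E →ₗ.[ℂ] E} {V R : E →L[ℂ] E} {a b : ℝ} {z : ℂ}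

theorem re_inner_smul_self (z : ℂ) (x : E) : (⟪x, z • x⟫_ℂ).re = z.re * ‖x‖ ^ 2 := by
  rw [inner_smul_right, inner_self_eq_norm_sq_to_K]
  exact Complex.ofReal_pow ‖x‖ 2 ▸ Complex.re_mul_ofReal z (‖x‖ ^ 2)

theorem mul_norm_sq_le_re_inner (hT : ∀ w ∈ numericalRange T, b ≤ w.re) (x : T.domain) :
    b * ‖(x : E)‖ ^ 2 ≤ (⟪(x : E), T x⟫_ℂ).re := by
  obtain hx | hx := eq_or_ne (x : E) 0
  · simp [hx]
  have hx' : ‖(x : E)‖ ≠ 0 := norm_ne_zero_iff.2 hx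
  let u : T.domain := ((‖(x : E)‖⁻¹ : ℝ) : ℂ) • x
  have hu : ‖(u : E)‖ = 1 := by simp [u, norm_smul, hx']
  have hxu : (⟪(u : E), T u⟫_ℂ).re = (⟪(x : E), T x⟫_ℂ).re / ‖(x : E)‖ ^ 2 := by
    rw [T.map_smul, Submodule.coe_smul, inner_smul_left, inner_smul_right, Complex.conj_ofReal,
      Complex.re_ofReal_mul, Complex.re_ofReal_mul]
    field_simp
  have hb := hT _ ⟨u, hu, rfl⟩
  rwa [hxu, le_div_iff₀ (by positivity)] at hb

theorem sub_re_mul_norm_le_norm_sub_smul (hT : ∀ w ∈ numericalRange T, b ≤ w.re) (z : ℂ)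
    (x : T.domain) : (b - z.re) * ‖(x : E)‖ ≤ ‖T x - z • (x : E)‖ := by
  obtain hx | hx := eq_or_ne (x : E) 0
  · simp [hx]
  refine le_of_mul_le_mul_left ?_ (norm_pos_iff.2 hx)
  calc ‖(x : E)‖ * ((b - z.re) * ‖(x : E)‖) = b * ‖(x : E)‖ ^ 2 - z.re * ‖(x : E)‖ ^ 2 := by ring
    _ ≤ (⟪(x : E), T x⟫_ℂ).re - (⟪(x : E), z • (x : E)⟫_ℂ).re := by
        rw [re_inner_smul_self]
        gcongr
        exact mul_norm_sq_le_re_inner hT x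
    _ = (⟪(x : E), T x - z • (x : E)⟫_ℂ).re := by rw [inner_sub_right, Complex.sub_re]
    _ ≤ ‖(x : E)‖ * ‖T x - z • (x : E)‖ := re_inner_le_norm (𝕜 := ℂ) _ _

theorem IsResolventAt.norm_le (hR : IsResolventAt T z R)
    (hT : ∀ w ∈ numericalRange T, b ≤ w.re) (hz : z.re < b) : ‖R‖ ≤ (b - z.re)⁻¹ := by
  have hbz : 0 < b - z.re := sub_pos.2 hz
  refine R.opNorm_le_bound (inv_nonneg.2 hbz.le) fun y => ?_
  have hy := sub_re_mul_norm_le_norm_sub_smul hT z ⟨R y, hR.mem_domain y⟩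
  rw [hR.sub_smul_apply] at hy
  rwa [inv_mul_eq_div, le_div_iff₀' hbz]

theorem le_re_of_mem_spec [CompleteSpace E] (hT : ∀ w ∈ numericalRange T, b ≤ w.re)
    (hne : (resolventSet T ∩ {z : ℂ | z.re < b}).Nonempty) (hz : z ∈ spec T) : b ≤ z.re := by
  by_contra! hzb
  refine hz <| (convex_halfSpace_re_lt b).isPreconnected.subset_of_closure_inter_subset
    (isOpen_resolventSet T) (by rwa [Set.inter_comm]) ?_ hzb
  rintro w ⟨hw, hwb : w.re < b⟩
  obtain ⟨v, hv, hwv⟩ := Metric.mem_closure_iff.1 hw ((b - w.re) / 2) (half_pos (sub_pos.2 hwb))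
  obtain ⟨R, hR⟩ := mem_resolventSet_iff.1 hv
  rw [dist_eq_norm] at hwv
  have hdist : ‖w - v‖ < b - v.re := by
    have hre : v.re - w.re ≤ ‖w - v‖ := by
      rw [norm_sub_rev, ← Complex.sub_re]
      exact Complex.re_le_norm _
    linarith
  have hvb : 0 < b - v.re := (norm_nonneg _).trans_lt hdist
  refine hR.mem_resolventSet_of_norm_sub_mul_lt_one ?_
  calc ‖w - v‖ * ‖R‖ ≤ ‖w - v‖ * (b - v.re)⁻¹ := by
        gcongr
        exact hR.norm_le hT (sub_pos.1 hvb)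
    _ < 1 := by rwa [← div_eq_mul_inv, div_lt_one hvb]

theorem le_re_of_mem_numericalRange_addBounded (hT : ∀ w ∈ numericalRange T, b ≤ w.re)
    (hV : ∀ x, 0 ≤ (⟪x, V x⟫_ℂ).re) : ∀ w ∈ numericalRange (addBounded T V), b ≤ w.re := by
  rintro _ ⟨x, hx, rfl⟩
  rw [addBounded_apply T V x, inner_add_right, Complex.add_re]
  exact le_add_of_le_of_nonneg (hT _ ⟨x, hx, rfl⟩) (hV x)

theorem le_re_of_mem_spec_addBounded [CompleteSpace E] (hT : ∀ w ∈ numericalRange T, b ≤ w.re)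
    (hV : ∀ x, 0 ≤ (⟪x, V x⟫_ℂ).re) (hne : (resolventSet T ∩ {z : ℂ | z.re < b}).Nonempty)
    (hz : z ∈ spec (addBounded T V)) : b ≤ z.re := by
  refine le_re_of_mem_spec (le_re_of_mem_numericalRange_addBounded hT hV) ?_ hz
  have hpos : 0 < ‖V‖ + 1 := by positivity
  let t : ℂ := (b - (‖V‖ + 1) : ℝ)
  have htb : t.re < b := sub_lt_self b hpos
  obtain ⟨R, hR⟩ := mem_resolventSet_iff.1 <|
    not_not.1 fun ht => htb.not_ge (le_re_of_mem_spec hT hne ht)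
  have hRV : ‖R‖ ≤ (‖V‖ + 1)⁻¹ := by simpa [t] using hR.norm_le hT htb
  refine ⟨t, hR.mem_resolventSet_addBounded V ?_, htb⟩
  calc ‖V‖ * ‖R‖ ≤ ‖V‖ * (‖V‖ + 1)⁻¹ := by gcongr
    _ < 1 := by rw [← div_eq_mul_inv, div_lt_one hpos]; exact lt_add_one _

theorem numericalRange_neg (T : E →ₗ.[ℂ] E) : numericalRange (-T) = -numericalRange T := by
  ext w
  simp only [Set.mem_neg, numericalRange, Set.mem_ofPred_eq, ← neg_eq_iff_eq_neg,
    ← inner_neg_right]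
  rfl

theorem re_le_of_mem_spec_addBounded [CompleteSpace E] (hT : ∀ w ∈ numericalRange T, w.re ≤ a)
    (hV : ∀ x, (⟪x, V x⟫_ℂ).re ≤ 0) (hne : (resolventSet T ∩ {z : ℂ | a < z.re}).Nonempty)
    (hz : z ∈ spec (addBounded T V)) : z.re ≤ a := by
  refine neg_le_neg_iff.1 (le_re_of_mem_spec_addBounded (T := -T) (V := -V) ?_ ?_ ?_
    (neg_mem_spec_addBounded_neg hz))
  · rw [numericalRange_neg]
    exact fun w hw => neg_le.1 (hT (-w) hw)
  · simpa using hV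
  · obtain ⟨w, hw, haw⟩ := hne
    rw [resolventSet_neg]
    exact ⟨-w, Set.neg_mem_neg.2 hw, neg_lt_neg (show a < w.re from haw)⟩

end NumericalRange

section Symmetric

variable {E : Type*} [NormedAddCommGroup E] [InnerProductSpace ℂ E]
  {T : E →ₗ.[ℂ] E} {V R : E →L[ℂ] E} {b t : ℝ} {z : ℂ}

theorem isFormalAdjoint_neg_neg {𝕜 F G : Type*} [RCLike 𝕜] [NormedAddCommGroup F]
    [InnerProductSpace 𝕜 F] [NormedAddCommGroup G] [InnerProductSpace 𝕜 G] {T : F →ₗ.[𝕜] G}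
    {S : G →ₗ.[𝕜] F} (h : T.IsFormalAdjoint S) : (-T).IsFormalAdjoint (-S) := fun x y => by
  simpa only [LinearPMap.neg_apply, inner_neg_left, inner_neg_right, neg_inj] using h x y

theorem IsResolventAt.isSymmetric (hR : IsResolventAt T t R) (hT : T.IsFormalAdjoint T) :
    (R : E →ₗ[ℂ] E).IsSymmetric := fun u v => by
  have huv := hT ⟨R u, hR.mem_domain u⟩ ⟨R v, hR.mem_domain v⟩
  calc ⟪R u, v⟫_ℂ = ⟪R u, T ⟨R v, hR.mem_domain v⟩ - (t : ℂ) • R v⟫_ℂ := by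
        rw [hR.sub_smul_apply]
    _ = ⟪T ⟨R u, hR.mem_domain u⟩ - (t : ℂ) • R u, R v⟫_ℂ := by
        rw [inner_sub_left, inner_sub_right, inner_smul_left, inner_smul_right,
          Complex.conj_ofReal, huv]
    _ = ⟪u, R v⟫_ℂ := by rw [hR.sub_smul_apply]

variable [CompleteSpace E]

theorem isFormalAdjoint_self_of_isSelfAdjoint (hT : IsSelfAdjoint T) : T.IsFormalAdjoint T := by
  have hadj := T.adjoint_isFormalAdjoint hT.dense_domain
  rwa [LinearPMap.isSelfAdjoint_def.1 hT] at hadj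

theorem IsResolventAt.isPositive (hR : IsResolventAt T t R) (hT : T.IsFormalAdjoint T)
    (hb : ∀ s : ℝ, s < b → (s : ℂ) ∈ resolventSet T) (htb : t < b) : R.IsPositive := by
  have hsa : IsSelfAdjoint R :=
    ContinuousLinearMap.isSelfAdjoint_iff_isSymmetric.2 (hR.isSymmetric hT)
  rw [← ContinuousLinearMap.nonneg_iff_isPositive,
    StarOrderedRing.nonneg_iff_spectrum_nonneg (R := ℝ) R hsa]
  intro c hc
  by_contra! hneg
  obtain ⟨S, hS⟩ := mem_resolventSet_iff.1 (hb (t + c⁻¹) (by linarith [inv_lt_zero.2 hneg]))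
  push_cast at hS
  refine hc ?_
  rw [spectrum.mem_resolventSet_iff, Algebra.algebraMap_eq_smul_one]
  exact hR.isUnit_smul_one_sub (Complex.ofReal_ne_zero.2 hneg.ne) hS

theorem le_re_of_mem_numericalRange_of_forall_lt_mem_resolventSet (hT : T.IsFormalAdjoint T)
    (hb : ∀ s : ℝ, s < b → (s : ℂ) ∈ resolventSet T) : ∀ w ∈ numericalRange T, b ≤ w.re := by
  rintro _ ⟨x, hx, rfl⟩
  refine le_of_forall_lt_imp_le_of_dense fun t htb => ?_
  obtain ⟨R, hR⟩ := mem_resolventSet_iff.1 (hb t htb)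
  have hpos : 0 ≤ (⟪R (T x - (t : ℂ) • (x : E)), T x - (t : ℂ) • (x : E)⟫_ℂ).re :=
    (hR.isPositive hT hb htb).re_inner_nonneg_left _
  rw [hR.apply_sub_smul, inner_sub_right, Complex.sub_re, re_inner_smul_self, hx] at hpos
  simpa using hpos

theorem realInf_spec_le_re_of_mem_spec_addBounded (hT : T.IsFormalAdjoint T)
    (hV : ∀ x, 0 ≤ (⟪x, V x⟫_ℂ).re) (hz : z ∈ spec (addBounded T V)) :
    realInf (spec T) ≤ (z.re : EReal) := by
  by_contra! hlt
  obtain ⟨c, hzc, hc⟩ := EReal.lt_iff_exists_real_btwn.1 hlt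
  have hρ (s : ℝ) (hs : s < c) : (s : ℂ) ∈ resolventSet T := by
    by_contra hmem
    exact ((EReal.coe_lt_coe_iff.2 hs).trans hc).not_ge (sInf_le (Set.mem_image_of_mem _ hmem))
  refine (EReal.coe_lt_coe_iff.1 hzc).not_ge (le_re_of_mem_spec_addBounded
    (le_re_of_mem_numericalRange_of_forall_lt_mem_resolventSet hT hρ) hV ?_ hz)
  exact ⟨((c - 1 : ℝ) : ℂ), hρ _ (sub_one_lt c), sub_one_lt c⟩

theorem re_le_realSup_spec_of_mem_spec_addBounded (hT : T.IsFormalAdjoint T)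
    (hV : ∀ x, (⟪x, V x⟫_ℂ).re ≤ 0) (hz : z ∈ spec (addBounded T V)) :
    (z.re : EReal) ≤ realSup (spec T) := by
  have h := realInf_spec_le_re_of_mem_spec_addBounded (isFormalAdjoint_neg_neg hT)
    (V := -V) (by simpa using hV) (neg_mem_spec_addBounded_neg hz)
  rwa [spec_neg, realInf_neg, Complex.neg_re, EReal.coe_neg, EReal.neg_le_neg_iff] at h

end Symmetric

section SkewAdjoint

variable {H : Type*} [NormedAddCommGroup H] [InnerProductSpace ℂ H] [CompleteSpace H]

theorem re_inner_apply_self_of_mem_skewAdjoint {V : H →L[ℂ] H} (hV : V ∈ skewAdjoint (H →L[ℂ] H))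
    (x : H) : (⟪x, V x⟫_ℂ).re = 0 := by
  have hVx : (⟪x, V x⟫_ℂ).re = -(⟪x, V x⟫_ℂ).re :=
    calc (⟪x, V x⟫_ℂ).re = (⟪star V x, x⟫_ℂ).re := by
          rw [ContinuousLinearMap.star_eq_adjoint, ContinuousLinearMap.adjoint_inner_left]
      _ = -(⟪V x, x⟫_ℂ).re := by
          rw [skewAdjoint.mem_iff.1 hV, _root_.neg_apply, inner_neg_left, Complex.neg_re]
      _ = -(⟪x, V x⟫_ℂ).re := congrArg Neg.neg (inner_re_symm (𝕜 := ℂ) _ _)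
  linarith

theorem adjoint_offDiag (H₀ : Submodule ℂ H) [CompleteSpace H₀] (B : H₀ᗮ →L[ℂ] H₀)
    (C : H₀ →L[ℂ] H₀ᗮ) :
    ContinuousLinearMap.adjoint (offDiag H₀ B C) =
      offDiag H₀ (ContinuousLinearMap.adjoint C) (ContinuousLinearMap.adjoint B) := by
  simp only [offDiag, map_add, ContinuousLinearMap.adjoint_comp, Submodule.adjoint_subtypeL,
    Submodule.adjoint_orthogonalProjectionOnto, ContinuousLinearMap.comp_assoc]
  exact add_comm _ _

theorem offDiag_neg_adjoint_mem_skewAdjoint (H₀ : Submodule ℂ H) [CompleteSpace H₀]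
    (B : H₀ᗮ →L[ℂ] H₀) :
    offDiag H₀ B (-ContinuousLinearMap.adjoint B) ∈ skewAdjoint (H →L[ℂ] H) := by
  rw [skewAdjoint.mem_iff, ContinuousLinearMap.star_eq_adjoint, adjoint_offDiag, map_neg,
    ContinuousLinearMap.adjoint_adjoint]
  simp [offDiag, add_comm]

end SkewAdjoint

end BlockOp

theorem theorem5p8_general {H : Type*} [NormedAddCommGroup H] [InnerProductSpace ℂ H]
    [CompleteSpace H] (T : H →ₗ.[ℂ] H) (V : H →L[ℂ] H) (hV : V ∈ skewAdjoint (H →L[ℂ] H))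
    (a b : ℝ) :
    ((∀ w ∈ BlockOp.numericalRange T, w.re ≤ a) →
      (BlockOp.resolventSet T ∩ {z : ℂ | a < z.re}).Nonempty →
      ∀ z ∈ BlockOp.spec (BlockOp.addBounded T V), z.re ≤ a) ∧
    ((∀ w ∈ BlockOp.numericalRange T, b ≤ w.re) →
      (BlockOp.resolventSet T ∩ {z : ℂ | z.re < b}).Nonempty →
      ∀ z ∈ BlockOp.spec (BlockOp.addBounded T V), b ≤ z.re) ∧
    (T.IsFormalAdjoint T →
      ∀ z ∈ BlockOp.spec (BlockOp.addBounded T V),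
        BlockOp.realInf (BlockOp.spec T) ≤ (z.re : EReal) ∧
        (z.re : EReal) ≤ BlockOp.realSup (BlockOp.spec T)) := by
  have hVre (x : H) : (⟪x, V x⟫_ℂ).re = 0 :=
    BlockOp.re_inner_apply_self_of_mem_skewAdjoint hV x
  have hVle (x : H) : (⟪x, V x⟫_ℂ).re ≤ 0 := (hVre x).le
  have hVge (x : H) : 0 ≤ (⟪x, V x⟫_ℂ).re := (hVre x).ge
  exact ⟨fun hT hne _ hz => BlockOp.re_le_of_mem_spec_addBounded hT hVle hne hz,
    fun hT hne _ hz => BlockOp.le_re_of_mem_spec_addBounded hT hVge hne hz,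
    fun hT _ hz => ⟨BlockOp.realInf_spec_le_re_of_mem_spec_addBounded hT hVge hz,
      BlockOp.re_le_realSup_spec_of_mem_spec_addBounded hT hVle hz⟩⟩

/-- Spectral enclosure for `L = A + V` with `A = diag(A₀, A₁)` closed and `V` off-diagonal with
entries `B` and `C = -B*`, on `H = H₀ ⊕ H₀ᗮ`. -/
theorem theorem5p8 {H : Type*} [NormedAddCommGroup H] [InnerProductSpace ℂ H] [CompleteSpace H]
    (H₀ : Submodule ℂ H) [CompleteSpace H₀]
    (A₀ : H₀ →ₗ.[ℂ] H₀) (A₁ : H₀ᗮ →ₗ.[ℂ] H₀ᗮ) (hA₀ : A₀.IsClosed) (hA₁ : A₁.IsClosed)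
    (B : H₀ᗮ →L[ℂ] H₀) (C : H₀ →L[ℂ] H₀ᗮ) (hC : C = -ContinuousLinearMap.adjoint B)
    (A L : H →ₗ.[ℂ] H) (hA : A = BlockOp.blockDiag H₀ A₀ A₁)
    (hL : L = BlockOp.addBounded A (BlockOp.offDiag H₀ B C)) (a b : ℝ) :
    ((∀ w ∈ BlockOp.numericalRange A, w.re ≤ a) →
      (BlockOp.resolventSet A ∩ {z : ℂ | a < z.re}).Nonempty →
      ∀ z ∈ BlockOp.spec L, z.re ≤ a) ∧
    ((∀ w ∈ BlockOp.numericalRange A, b ≤ w.re) →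
      (BlockOp.resolventSet A ∩ {z : ℂ | z.re < b}).Nonempty →
      ∀ z ∈ BlockOp.spec L, b ≤ z.re) ∧
    (IsSelfAdjoint A →
      ∀ z ∈ BlockOp.spec L,
        BlockOp.realInf (BlockOp.spec A) ≤ (z.re : EReal) ∧
        (z.re : EReal) ≤ BlockOp.realSup (BlockOp.spec A)) := by
  subst hL hC
  have ⟨hupper, hlower, hsymm⟩ := theorem5p8_general A _
    (BlockOp.offDiag_neg_adjoint_mem_skewAdjoint H₀ B) a b
  exact ⟨hupper, hlower, fun hsa => hsymm (BlockOp.isFormalAdjoint_self_of_isSelfAdjoint hsa)⟩
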